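/- Let $d\ge 2$, let $N_1,\dots,N_d$ be positive integers, and let $B$ be a complex $d$-way tensor with entries $B(k_1,\dots,k_d)$, $|k_i|\le N_i-1$. Let $T$ be the $d$-level block Toeplitz matrix of order $\prod_i N_i$, with rows and columns indexed by multi-indices $m=(m_1,\dots,m_d)$, $n=(n_1,\dots,n_d)$, $1\le m_i,n_i\le N_i$, and entries $T(m,n)=B(m_1-n_1,\dots,m_d-n_d)$. Put $r=\operatorname{rank}(T)$ and assume $r<\min_i N_i$. For each $i$ let $f_{L,i},f_{H,i}\in[0,1)$ with $f_{L,i}\ne f_{H,i}$, and let $F_i=[f_{L,i},f_{H,i}]$ be the closed interval if $f_{L,i}<f_{H,i}$, and $F_i=[0,1)\setminus(f_{H,i},f_{L,i})$ if $f_{L,i}>f_{H,i}$. Put $$r_{0,i}=-2\cos\big(\pi(f_{H,i}-f_{L,i})\big)\operatorname{sign}(f_{H,i}-f_{L,i}),\qquad r_{1,i}=e^{\mathrm i\pi(f_{L,i}+f_{H,i})}\operatorname{sign}(f_{H,i}-f_{L,i}),\qquad r_{-1,i}=\overline{r_{1,i}},$$ the coefficients of the trigonometric polynomial $g_i(f)=r_{1,i}e^{-\mathrm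 i2\pi f}+r_{0,i}+r_{-1,i}e^{\mathrm i2\pi f}$, and let $T_{g_i}$ be the $d$-level block Toeplitz matrix of order $\prod_j(N_j-1)$ with entries $$T_{g_i}(m,n)=\sum_{k=-1}^{1}r_{k,i}\,B(m_1-n_1,\dots,m_i-n_i-k,\dots,m_d-n_d),\qquad 1\le m_j,n_j\le N_j-1.$$ For $f=(f_1,\dots,f_d)\in[0,1)^d$ let $a(f)=s_1(f_1)\otimes\cdots\otimes s_d(f_d)$, where $s_i(f_i)=(1,e^{\mathrm i2\pi f_i},\dots,e^{\mathrm i2\pi(N_i-1)f_i})^{\mathsf T}$. A multidimensional Vandermonde decomposition of $T$ is a representation $$T=\sum_{\ell=1}^{r}\sigma_\ell\,a(f_{:,\ell})\,a(f_{:,\ell})^{\mathsf H}$$ with $\sigma_\ell>0$ and distinct $f_{:,\ell}=(f_{1,\ell},\dots,f_{d,\ell})\in[0,1)^d$, $\ell=1,\dots,r$. Then $T$ has a multidimensional Vandermonde decomposition with $f_{i,\ell}\in F_i$ for all $i=1,\dots,d$ and $\ell=1,\dots,r$ if and only if $T\succeq0$ and $T_{g_i}\succeq0$ for all $i=1,\dots,d$.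 Moreover, the pairs $(f_{:,\ell},\sigma_\ell)$ in a multidimensional Vandermonde decomposition of $T$ are unique up to order. -/

import Mathlib

open scoped ComplexOrder

noncomputable section

namespace MDToeplitz

variable {d : ℕ}

/-- Row and column multi-indices `(k₁, …, k_d)`, `0 ≤ kᵢ < Nᵢ`, of a `d`-level matrix with level
sizes `N₁, …, N_d`; there are `∏ᵢ Nᵢ` of them. -/
abbrev MultiIndex (N : Fin d → ℕ) : Type := (i : Fin d) → Fin (N i)

/-- The difference `(m₁ - n₁, …, m_d - n_d)` of two multi-indices. -/
def lag {N : Fin d → ℕ} (m n : MultiIndex N) : Fin d → ℤ :=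
  fun i => ((m i : ℕ) : ℤ) - ((n i : ℕ) : ℤ)

/-- The `d`-level block Toeplitz matrix generated by the `d`-way tensor `B`:
`T(m₁,n₁; …; m_d,n_d) = B(m₁ - n₁, …, m_d - n_d)`.  Only the entries of `B` with
`|kᵢ| ≤ Nᵢ - 1` for all `i` occur, so `B` amounts to a tensor of format
`(2N₁-1) × … × (2N_d-1)`. -/
def blockToeplitz (N : Fin d → ℕ) (B : (Fin d → ℤ) → ℂ) :
    Matrix (MultiIndex N) (MultiIndex N) ℂ :=
  Matrix.of fun m n => B (lag m n)

/-- The sampled complex sinusoid `s(f) = (1, e^{i2πf}, …, e^{i2π(n-1)f})`. -/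
def sinusoid (n : ℕ) (f : ℝ) : Fin n → ℂ :=
  fun k => Complex.exp (2 * Real.pi * Complex.I * ((k : ℕ) : ℂ) * (f : ℂ))

/-- The `d`-dimensional complex sinusoid `a(f) = s₁(f₁) ⊗ … ⊗ s_d(f_d)`. -/
def atom (N : Fin d → ℕ) (f : Fin d → ℝ) : MultiIndex N → ℂ :=
  fun k => ∏ i, sinusoid (N i) (f i) (k i)

/-- `T = ∑ σ_ℓ a(f_ℓ) a(f_ℓ)ᴴ` with `rank T` terms, positive weights `σ_ℓ`, and distinct
frequency vectors `f_ℓ ∈ [0,1)^d`. -/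
structure IsVandermondeDecomposition {N : Fin d → ℕ}
    (T : Matrix (MultiIndex N) (MultiIndex N) ℂ)
    (σ : Fin T.rank → ℝ) (f : Fin T.rank → Fin d → ℝ) : Prop where
  pos : ∀ l, 0 < σ l
  mem_unit : ∀ l i, f l i ∈ Set.Ico (0 : ℝ) 1
  distinct : Function.Injective f
  eq_sum : T = ∑ l, (σ l : ℂ) • Matrix.vecMulVec (atom N (f l)) (star (atom N (f l)))

/-- The frequency interval `[fL, fH]` in `[0,1)`, read cyclically: it is the usual closed interval
if `fL < fH`, and `[0,1) \ (fH, fL)` if `fL > fH`. -/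
def freqInterval (fL fH : ℝ) : Set ℝ :=
  if fL < fH then Set.Icc fL fH else Set.Ico 0 1 \ Set.Ioo fH fL

/-- `r₀ = -2 cos(π(fH - fL)) sign(fH - fL)`. -/
def coeffZero (fL fH : ℝ) : ℝ :=
  -2 * Real.cos (Real.pi * (fH - fL)) * Real.sign (fH - fL)

/-- `r₁ = e^{iπ(fL + fH)} sign(fH - fL)`. -/
def coeffOne (fL fH : ℝ) : ℂ :=
  Complex.exp (Complex.I * Real.pi * (fL + fH)) * (Real.sign (fH - fL) : ℂ)

/-- The coefficients `r₋₁ = conj r₁, r₀, r₁` of the trigonometric polynomial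
`g(f) = r₁ e^{-i2πf} + r₀ + r₋₁ e^{i2πf} = r₀ + 2 Re (r₁ e^{-i2πf})`. -/
def coeff (fL fH : ℝ) (k : ℤ) : ℂ :=
  if k = 0 then (coeffZero fL fH : ℂ)
  else if k = 1 then coeffOne fL fH
  else if k = -1 then star (coeffOne fL fH)
  else 0

/-- The `d`-level block Toeplitz matrix with level sizes `Nⱼ - 1` and entries
`∑_{k=-1}^{1} r_k B(m₁ - n₁, …, mᵢ - nᵢ - k, …, m_d - n_d)`, where `r₋₁, r₀, r₁` are the
coefficients of the trigonometric polynomial `g` attached to `[fL, fH]`. -/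
def weightedToeplitz (N : Fin d → ℕ) (B : (Fin d → ℤ) → ℂ) (i : Fin d) (fL fH : ℝ) :
    Matrix (MultiIndex fun j => N j - 1) (MultiIndex fun j => N j - 1) ℂ :=
  blockToeplitz (fun j => N j - 1) fun t =>
    ∑ k ∈ Finset.Icc (-1 : ℤ) 1, coeff fL fH k * B (t - Pi.single i k)

end MDToeplitz

end

/-!
Write a positive semidefinite `T` as the Gram matrix of vectors `w m` spanning a space `E` of
dimension `r = rank T`. The Toeplitz structure says that shifting all indices by one in the `i`-th
coordinate preserves inner products. Since `r < Nᵢ` for every `i`, already the `w m` with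
`mᵢ < Nᵢ - 1` for all `i` span `E` (`span_box_pred`): the dimensions of the layers
`span {w m | mᵢ < k}` have to stall before `k = Nᵢ`, and by stationarity they then stall for good.
So the shifts extend to linear isometries of `E`, which commute because they do so on the smaller
box, and are therefore jointly diagonalizable. Splitting `w 0` into joint eigenvectors `c_χ` gives
`w m = ∑ χ^m c_χ` with orthogonal `c_χ` (`exists_spectral_representation`), that is, a decomposition
of `T` into atoms with weights `‖c_χ‖²`; comparing ranks, it has exactly `r` terms.

Everything else rests on interpolation: a point of `ℂ^d` is separated from `n` others by a
polynomial of degree at most `n` in each variable (`exists_separating`). Testing the quadratic form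
of `T` on the coefficient vectors of such polynomials gives uniqueness; for this `r + 1 ≤ Nᵢ` is just
enough. The matrix `T_g` has the same frequencies as `T`, with the weights multiplied by the values
of `g` (`weightedToeplitz_eq_sum`); as `r ≤ Nᵢ - 1`, its shorter atoms are still separated, so `T_g`
is positive semidefinite exactly when `g` is nonnegative at all frequencies. Finally `g` factors as
`-4 sign(f_H - f_L) sin(π(x - f_L)) sin(π(x - f_H))`, which is nonnegative on `[0, 1)` exactly on the
frequency interval (`trigPoly_nonneg_iff`).
-/

noncomputable section

namespace MDToeplitz

/-! ### Stationary families and their shifts -/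

variable {d : ℕ} {E : Type*} [NormedAddCommGroup E] [InnerProductSpace ℂ E]

/-- The exponents `m ∈ ℕ^d` with `mᵢ < Nᵢ` for all `i`. -/
def box (N : Fin d → ℕ) : Set (Fin d → ℕ) := {m | ∀ i, m i < N i}

/-- The Gram matrix of the vectors `w m`, `m ∈ box N`, is `d`-level Toeplitz. -/
def IsStationaryOn (N : Fin d → ℕ) (w : (Fin d → ℕ) → E) : Prop :=
  ∀ m ∈ box N, ∀ n ∈ box N, ∀ m' ∈ box N, ∀ n' ∈ box N,
    (∀ i, (m i : ℤ) - n i = m' i - n' i) → inner ℂ (w m) (w n) = inner ℂ (w m') (w n')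

theorem mem_box_of_add_single {N : Fin d → ℕ} {m : Fin d → ℕ} {i : Fin d}
    (h : m + Pi.single i 1 ∈ box N) : m ∈ box N := fun j => by
  have := h j
  simp only [Pi.add_apply] at this
  omega

theorem exists_eq_add_single {m : Fin d → ℕ} {i : Fin d} (h : m i ≠ 0) :
    ∃ m' : Fin d → ℕ, m = m' + Pi.single i 1 := by
  refine ⟨m - Pi.single i 1, funext fun j => ?_⟩
  rcases eq_or_ne j i with rfl | hj
  · simp only [Pi.add_apply, Pi.sub_apply, Pi.single_eq_same]; omega
  · simp [hj]

theorem norm_linearCombination_shift {N : Fin d → ℕ} {w : (Fin d → ℕ) → E}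
    (hw : IsStationaryOn N w) (i : Fin d) {c : (Fin d → ℕ) →₀ ℂ}
    (hc : ∀ m ∈ c.support, m + Pi.single i 1 ∈ box N) :
    ‖Finsupp.linearCombination ℂ (fun m => w (m + Pi.single i 1)) c‖ =
      ‖Finsupp.linearCombination ℂ w c‖ := by
  have key : inner ℂ (Finsupp.linearCombination ℂ (fun m => w (m + Pi.single i 1)) c)
      (Finsupp.linearCombination ℂ (fun m => w (m + Pi.single i 1)) c) =
      inner ℂ (Finsupp.linearCombination ℂ w c) (Finsupp.linearCombination ℂ w c) := by
    simp only [Finsupp.linearCombination_apply, Finsupp.sum, sum_inner, inner_sum,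
      inner_smul_left, inner_smul_right]
    refine Finset.sum_congr rfl fun m hm => ?_
    congr 1
    refine Finset.sum_congr rfl fun n hn => ?_
    rw [hw _ (hc n hn) _ (hc m hm) _ (mem_box_of_add_single (hc n hn)) _
      (mem_box_of_add_single (hc m hm)) (fun j => by simp)]
  rw [inner_self_eq_norm_sq_to_K, inner_self_eq_norm_sq_to_K] at key
  exact (sq_eq_sq₀ (norm_nonneg _) (norm_nonneg _)).1 (by exact_mod_cast key)

/-- A linear relation among the `w m` survives a shift by one in the `i`-th coordinate, as long as
the shifted indices stay in the box. -/
theorem mem_span_shift {N : Fin d → ℕ} {w : (Fin d → ℕ) → E} (hw : IsStationaryOn N w)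
    (i : Fin d) {S : Set (Fin d → ℕ)} (hS : ∀ m ∈ S, m + Pi.single i 1 ∈ box N)
    {m : Fin d → ℕ} (hm : m + Pi.single i 1 ∈ box N) (h : w m ∈ Submodule.span ℂ (w '' S)) :
    w (m + Pi.single i 1) ∈ Submodule.span ℂ ((fun n => w (n + Pi.single i 1)) '' S) := by
  classical
  obtain ⟨c, hcS, hc⟩ := (Finsupp.mem_span_image_iff_linearCombination ℂ).1 h
  refine (Finsupp.mem_span_image_iff_linearCombination ℂ).2 ⟨c, hcS, ?_⟩
  have hsupp : ∀ n ∈ (c - Finsupp.single m 1).support, n + Pi.single i 1 ∈ box N := by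
    intro n hn
    rcases Finset.mem_union.1 (Finsupp.support_sub hn) with hn | hn
    · exact hS n ((Finsupp.mem_supported ℂ c).1 hcS hn)
    · rw [Finset.mem_singleton.1 (Finsupp.support_single_subset hn)]
      exact hm
  have := norm_linearCombination_shift hw i hsupp
  rw [map_sub, map_sub, hc] at this
  simpa [sub_eq_zero] using this

/-- A chain of `n` steps in a space of dimension below `n` stalls somewhere; if stalling propagates,
then its last step is trivial. -/
theorem eq_of_chain_of_finrank_lt [FiniteDimensional ℂ E] {n : ℕ} (G : ℕ → Submodule ℂ E)
    (hmono : ∀ k, k < n → G k ≤ G (k + 1))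
    (hstep : ∀ k, k + 1 < n → G k = G (k + 1) → G (k + 1) = G (k + 2))
    (hn : Module.finrank ℂ E < n) : G (n - 1) = G n := by
  by_contra hne
  have hne' : ∀ j, j < n → G (n - 1 - j) ≠ G (n - 1 - j + 1) := by
    intro j
    induction j with
    | zero => intro h; rwa [Nat.sub_zero, Nat.sub_add_cancel (by omega)]
    | succ j ih =>
      intro hj heq
      have h1 : n - 1 - (j + 1) + 1 = n - 1 - j := by omega
      have := hstep _ (by omega) heq
      rw [show n - 1 - (j + 1) + 2 = n - 1 - j + 1 by omega, h1] at this
      exact ih (by omega) this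
  have hlt : ∀ k, k < n → G k < G (k + 1) := by
    intro k hk
    refine lt_of_le_of_ne (hmono k hk) ?_
    have := hne' (n - 1 - k) (by omega)
    rwa [show n - 1 - (n - 1 - k) = k by omega] at this
  have hdim : ∀ k, k ≤ n → k ≤ Module.finrank ℂ (G k) := by
    intro k
    induction k with
    | zero => intro _; exact Nat.zero_le _
    | succ k ih =>
      intro hk
      exact (ih (by omega)).trans_lt (Submodule.finrank_lt_finrank_of_lt (hlt k (by omega)))
  have := (hdim n le_rfl).trans (Submodule.finrank_le (G n))
  omega

/-- Since the dimension is smaller than `Nᵢ`, the last layer in the direction `i` is redundant: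
along `k ↦ span {w m | mᵢ < k}` the dimension must stall, and by stationarity it stalls for
good. -/
theorem span_box_update [FiniteDimensional ℂ E] {N : Fin d → ℕ} {w : (Fin d → ℕ) → E}
    (hw : IsStationaryOn N w) (i : Fin d) (hi : Module.finrank ℂ E < N i) {K : Fin d → ℕ}
    (hK : K ≤ N) (hKi : K i = N i) :
    Submodule.span ℂ (w '' box (Function.update K i (N i - 1))) =
      Submodule.span ℂ (w '' box K) := by
  have hmem : ∀ (k : ℕ) (m : Fin d → ℕ), m ∈ box (Function.update K i k) ↔
      m i < k ∧ ∀ j, j ≠ i → m j < K j := by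
    intro k m
    constructor
    · intro h
      refine ⟨by simpa using h i, fun j hj => ?_⟩
      simpa [Function.update_of_ne hj] using h j
    · rintro ⟨h1, h2⟩ j
      rcases eq_or_ne j i with rfl | hj
      · simpa using h1
      · simpa [Function.update_of_ne hj] using h2 j hj
  have hshift : ∀ (k : ℕ) (m : Fin d → ℕ), m + Pi.single i 1 ∈ box (Function.update K i (k + 1)) ↔
      m ∈ box (Function.update K i k) := by
    intro k m
    rw [hmem, hmem]
    refine and_congr (by simp) (forall₂_congr fun j hj => by simp [hj])
  have hsub : ∀ k ≤ N i, box (Function.update K i k) ⊆ box N := by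
    intro k hk m hm j
    rcases eq_or_ne j i with rfl | hj
    · exact ((hmem _ _).1 hm).1.trans_le hk
    · exact (((hmem _ _).1 hm).2 j hj).trans_le (hK j)
  have hmonobox : ∀ k, box (Function.update K i k) ⊆ box (Function.update K i (k + 1)) := by
    intro k m hm
    rw [hmem] at hm ⊢
    exact ⟨by omega, hm.2⟩
  have hmono : ∀ k, Submodule.span ℂ (w '' box (Function.update K i k)) ≤
      Submodule.span ℂ (w '' box (Function.update K i (k + 1))) := fun k =>
    Submodule.span_mono (Set.image_mono (hmonobox k))
  have := eq_of_chain_of_finrank_lt (n := N i)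
    (fun k => Submodule.span ℂ (w '' box (Function.update K i k)))
    (fun k _ => hmono k) ?_ hi
  · simpa [← hKi] using this
  intro k hk heq
  refine le_antisymm (hmono _) (Submodule.span_le.2 ?_)
  rintro _ ⟨m, hm, rfl⟩
  by_cases hmi : m i < k + 1
  · exact Submodule.subset_span ⟨m, (hmem _ _).2 ⟨hmi, ((hmem _ _).1 hm).2⟩, rfl⟩
  obtain ⟨m, rfl⟩ := exists_eq_add_single (show m i ≠ 0 by omega)
  have hm' := (hshift _ _).1 hm
  -- The relation that expresses layer `k` by the earlier ones is shifted to layer `k + 1`.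
  have hwm : w m ∈ Submodule.span ℂ (w '' box (Function.update K i k)) := by
    have : w m ∈ Submodule.span ℂ (w '' box (Function.update K i (k + 1))) :=
      Submodule.subset_span ⟨m, hm', rfl⟩
    exact heq ▸ this
  have := mem_span_shift hw i (fun n hn => hsub _ (by omega) ((hshift _ _).2 hn))
    (hsub _ (by omega) hm) hwm
  refine Submodule.span_mono ?_ this
  rintro _ ⟨n, hn, rfl⟩
  exact ⟨_, (hshift _ _).2 hn, rfl⟩

/-- Trims the box by one in every coordinate; done one coordinate at a time, so that each step
applies to the box that has already been trimmed in the others. -/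
theorem span_box_pred [FiniteDimensional ℂ E] {N : Fin d → ℕ} {w : (Fin d → ℕ) → E}
    (hw : IsStationaryOn N w) (hN : ∀ i, Module.finrank ℂ E < N i)
    (hspan : Submodule.span ℂ (w '' box N) = ⊤) :
    Submodule.span ℂ (w '' box fun i => N i - 1) = ⊤ := by
  classical
  have : ∀ S : Finset (Fin d),
      Submodule.span ℂ (w '' box fun i => if i ∈ S then N i - 1 else N i) = ⊤ := by
    intro S
    induction S using Finset.induction_on with
    | empty => simpa using hspan
    | insert i S hi ih =>
      have h := span_box_update hw i (hN i) (K := fun j => if j ∈ S then N j - 1 else N j)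
        (fun j => by dsimp only; split_ifs <;> omega) (by simp [hi])
      rw [← ih, ← h]
      congr 3
      funext j
      rcases eq_or_ne j i with rfl | hj
      · simp
      · simp [hj]
  simpa using this Finset.univ

/-- Equality of norms makes `Φ c ↦ Ψ c` well defined and isometric. -/
theorem exists_linearIsometry {V : Type*} [AddCommGroup V] [Module ℂ V] (Φ Ψ : V →ₗ[ℂ] E)
    (hΦ : Function.Surjective Φ) (h : ∀ c, ‖Ψ c‖ = ‖Φ c‖) :
    ∃ U : E →ₗᵢ[ℂ] E, ∀ c, U (Φ c) = Ψ c := by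
  obtain ⟨g, hg⟩ := Φ.exists_rightInverse_of_surjective (LinearMap.range_eq_top.2 hΦ)
  have hg' : ∀ x, Φ (g x) = x := fun x => LinearMap.congr_fun hg x
  refine ⟨⟨Ψ ∘ₗ g, fun x => by simp [h, hg']⟩, fun c => ?_⟩
  have : ‖Ψ (g (Φ c) - c)‖ = 0 := by rw [h]; simp [hg']
  simpa [sub_eq_zero] using this

theorem exists_shift_isometry {N : Fin d → ℕ} {w : (Fin d → ℕ) → E}
    (hw : IsStationaryOn N w) (i : Fin d)
    (hspan : Submodule.span ℂ
      (w '' {m : Fin d → ℕ | m + Pi.single i 1 ∈ box N}) = ⊤) :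
    ∃ U : E →ₗᵢ[ℂ] E, ∀ m, m + Pi.single i 1 ∈ box N → U (w m) = w (m + Pi.single i 1) := by
  let S := {m : Fin d → ℕ | m + Pi.single i 1 ∈ box N}
  obtain ⟨U, hU⟩ := exists_linearIsometry
    (V := Finsupp.supported ℂ ℂ S)
    ((Finsupp.linearCombination ℂ w).domRestrict _)
    ((Finsupp.linearCombination ℂ fun m => w (m + Pi.single i 1)).domRestrict _)
    (fun x => by
      obtain ⟨c, hc, rfl⟩ := (Finsupp.mem_span_image_iff_linearCombination ℂ).1
        (show x ∈ Submodule.span ℂ (w '' S) from hspan ▸ Submodule.mem_top)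
      exact ⟨⟨c, hc⟩, rfl⟩)
    (fun c => norm_linearCombination_shift hw i ((Finsupp.mem_supported ℂ c.1).1 c.2))
  refine ⟨U, fun m hm => ?_⟩
  simpa using hU ⟨Finsupp.single m 1, Finsupp.single_mem_supported ℂ 1 hm⟩

/-! ### Commuting isometries and the spectral representation -/

/-- Orthogonal complements of invariant subspaces are invariant, because in finite dimension an
isometry maps an invariant subspace onto itself. -/
theorem isSemisimple_linearIsometry [FiniteDimensional ℂ E] (U : E →ₗᵢ[ℂ] E) :
    Module.End.IsSemisimple (U.toLinearMap : Module.End ℂ E) := by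
  rw [Module.End.isSemisimple_iff]
  intro p hp
  refine ⟨pᗮ, ?_, Submodule.isCompl_orthogonal p⟩
  rw [Module.End.mem_invtSubmodule] at hp ⊢
  have hmap : p.map U.toLinearMap = p := by
    refine Submodule.eq_of_le_of_finrank_eq (Submodule.map_le_iff_le_comap.2 hp) ?_
    exact (Submodule.equivMapOfInjective _ U.injective p).finrank_eq.symm
  intro x hx
  rw [Submodule.mem_comap, Submodule.mem_orthogonal]
  intro y hy
  rw [← hmap] at hy
  obtain ⟨z, hz, rfl⟩ := hy
  exact (U.inner_map_map z x).trans ((Submodule.mem_orthogonal p x).1 hx z hz)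

theorem iSup_joint_eigenspace_eq_top [FiniteDimensional ℂ E] {ι : Type*} [Finite ι]
    (U : ι → E →ₗᵢ[ℂ] E) (hU : ∀ i j x, U i (U j x) = U j (U i x)) :
    ⨆ χ : ι → ℂ, ⨅ i, Module.End.eigenspace ((U i).toLinearMap : Module.End ℂ E) (χ i) = ⊤ := by
  have h := Module.End.iSup_iInf_maxGenEigenspace_eq_top_of_iSup_maxGenEigenspace_eq_top_of_commute
    (fun i => ((U i).toLinearMap : Module.End ℂ E)) (fun i j _ => LinearMap.ext (hU i j))
    (fun i => Module.End.iSup_maxGenEigenspace_eq_top _)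
  simpa only [(isSemisimple_linearIsometry (U _)).isFinitelySemisimple.maxGenEigenspace_eq_eigenspace]
    using h

theorem norm_eigenvalue_eq_one {U : E →ₗᵢ[ℂ] E} {μ : ℂ} {x : E} (hx : U x = μ • x) (h0 : x ≠ 0) :
    ‖μ‖ = 1 := by
  have h := U.norm_map x
  rw [hx, norm_smul] at h
  exact mul_eq_right₀ (norm_ne_zero_iff.2 h0) |>.1 h

theorem inner_eq_zero_of_eigenvalue_ne {U : E →ₗᵢ[ℂ] E} {μ ν : ℂ} {x y : E} (hx : U x = μ • x)
    (hy : U y = ν • y) (h : μ ≠ ν) : inner ℂ x y = (0 : ℂ) := by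
  rcases eq_or_ne x 0 with rfl | hx0
  · simp
  have hμ := norm_eigenvalue_eq_one hx hx0
  have h1 := U.inner_map_map x y
  rw [hx, hy, inner_smul_left, inner_smul_right] at h1
  by_contra hne
  have h2 : starRingEnd ℂ μ * ν = 1 := by
    rw [← mul_assoc] at h1
    exact mul_eq_right₀ hne |>.1 h1
  have h3 : μ * starRingEnd ℂ μ = 1 := by
    rw [Complex.mul_conj, Complex.normSq_eq_norm_sq, hμ]; simp
  apply h
  calc μ = μ * (starRingEnd ℂ μ * ν) := by rw [h2, mul_one]
    _ = ν := by rw [← mul_assoc, h3, one_mul]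

/-- Spectral representation: a spanning stationary family of dimension below every `Nᵢ` is
`w m = ∑_χ χ^m c_χ` on the box, with mutually orthogonal nonzero `c_χ` and distinct unimodular
`χ`. -/
theorem exists_spectral_representation [FiniteDimensional ℂ E] {N : Fin d → ℕ}
    {w : (Fin d → ℕ) → E} (hw : IsStationaryOn N w) (hN : ∀ i, Module.finrank ℂ E < N i)
    (hspan : Submodule.span ℂ (w '' box N) = ⊤) :
    ∃ c : (Fin d → ℂ) →₀ E,
      (∀ χ ∈ c.support, ∀ i, ‖χ i‖ = 1) ∧
      (∀ χ ψ, χ ≠ ψ → inner ℂ (c χ) (c ψ) = (0 : ℂ)) ∧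
      ∀ m ∈ box N, w m = ∑ χ ∈ c.support, (∏ i, χ i ^ m i) • c χ := by
  have hpred := span_box_pred hw hN hspan
  have hadd : ∀ m ∈ box (fun i => N i - 1), ∀ i, m + Pi.single i 1 ∈ box N := by
    intro m hm i j
    have : m j < N j - 1 := hm j
    rcases eq_or_ne j i with rfl | hj
    · simp only [Pi.add_apply, Pi.single_eq_same]; omega
    · simp only [Pi.add_apply, Pi.single_eq_of_ne hj]; omega
  have hex := fun i => exists_shift_isometry hw i (top_le_iff.1
    (hpred ▸ Submodule.span_mono (Set.image_mono fun m hm => hadd m hm i)))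
  choose U hU using hex
  -- Both orders of shifting send `w m` to the same vector for `m` in the trimmed box, which spans.
  have hcomm : ∀ i j x, U i (U j x) = U j (U i x) := by
    intro i j x
    rcases eq_or_ne i j with rfl | hij
    · rfl
    have : (U i).toLinearMap ∘ₗ (U j).toLinearMap = (U j).toLinearMap ∘ₗ (U i).toLinearMap := by
      refine LinearMap.ext_on hpred ?_
      rintro _ ⟨m, hm, rfl⟩
      have h2 : ∀ i j : Fin d, i ≠ j → m + Pi.single j 1 + Pi.single i 1 ∈ box N := by
        intro i j hij k
        have : m k < N k - 1 := hm k
        rcases eq_or_ne k i with rfl | hk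
        · simp only [Pi.add_apply, Pi.single_eq_same, Pi.single_eq_of_ne hij]; omega
        · have := hadd m hm j k
          simpa [hk] using this
      simp only [LinearMap.comp_apply, LinearIsometry.coe_toLinearMap]
      rw [hU j m (hadd m hm j), hU i m (hadd m hm i), hU i _ (h2 i j hij),
        hU j _ (h2 j i hij.symm), add_right_comm]
    exact LinearMap.congr_fun this x
  obtain ⟨c, hc, hsum⟩ := (Submodule.mem_iSup_iff_exists_finsupp _ (w 0)).1
    (show w 0 ∈ ⨆ χ : Fin d → ℂ, ⨅ i,
      Module.End.eigenspace ((U i).toLinearMap : Module.End ℂ E) (χ i) from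
      (iSup_joint_eigenspace_eq_top U hcomm) ▸ Submodule.mem_top)
  have heig : ∀ χ i, U i (c χ) = χ i • c χ := fun χ i =>
    Module.End.mem_eigenspace_iff.1 ((Submodule.mem_iInf _).1 (hc χ) i)
  refine ⟨c, fun χ hχ i => norm_eigenvalue_eq_one (heig χ i) (Finsupp.mem_support_iff.1 hχ),
    fun χ ψ hne => ?_, fun m => ?_⟩
  · obtain ⟨i, hi⟩ := Function.ne_iff.1 hne
    exact inner_eq_zero_of_eigenvalue_ne (heig χ i) (heig ψ i) hi
  · induction hs : ∑ i, m i generalizing m with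
    | zero =>
      intro _
      have : m = 0 := funext fun i => by simpa using (Finset.sum_eq_zero_iff.1 hs) i
      subst this
      simp [← hsum, Finsupp.sum]
    | succ s ih =>
      intro hm
      obtain ⟨i, hi⟩ : ∃ i, m i ≠ 0 := by
        by_contra! h
        simp [h] at hs
      obtain ⟨m, rfl⟩ := exists_eq_add_single hi
      have hs' : ∑ i, m i = s := by
        simpa [Finset.sum_add_distrib] using hs
      rw [← hU i m hm, ih m hs' (mem_box_of_add_single hm), map_sum]
      refine Finset.sum_congr rfl fun χ _ => ?_
      rw [map_smul, heig, smul_smul]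
      congr 1
      simp only [Pi.add_apply, pow_add, Finset.prod_mul_distrib]
      congr 1
      rw [Finset.prod_eq_single i (fun j _ hj => by simp [hj]) (by simp)]
      simp

/-! ### Atoms as characters of the torus -/

/-- The point `(e^{i2πf₁}, …, e^{i2πf_d})` of the torus. -/
def phase (f : Fin d → ℝ) : Fin d → ℂ := fun i => Complex.exp (2 * Real.pi * Complex.I * f i)

theorem norm_phase (f : Fin d → ℝ) (i : Fin d) : ‖phase f i‖ = 1 := by
  rw [phase, Complex.norm_exp]
  simp

theorem phase_ne_zero (f : Fin d → ℝ) (i : Fin d) : phase f i ≠ 0 := Complex.exp_ne_zero _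

theorem conj_eq_inv_of_norm_eq_one {z : ℂ} (hz : ‖z‖ = 1) : starRingEnd ℂ z = z⁻¹ := by
  rw [Complex.inv_def, Complex.normSq_eq_norm_sq, hz]; simp

theorem atom_apply (N : Fin d → ℕ) (f : Fin d → ℝ) (k : MultiIndex N) :
    atom N f k = ∏ i, phase f i ^ (k i : ℕ) := by
  refine Finset.prod_congr rfl fun i _ => ?_
  rw [sinusoid, phase, ← Complex.exp_nat_mul]
  congr 1
  ring

theorem phase_injOn {f g : Fin d → ℝ} (hf : ∀ i, f i ∈ Set.Ico (0 : ℝ) 1)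
    (hg : ∀ i, g i ∈ Set.Ico (0 : ℝ) 1) (h : phase f = phase g) : f = g := by
  funext i
  obtain ⟨n, hn⟩ := Complex.exp_eq_exp_iff_exists_int.1 (congrFun h i)
  have h2 : (f i : ℂ) = g i + n := by
    have : (2 * Real.pi * Complex.I : ℂ) ≠ 0 := Complex.two_pi_I_ne_zero
    apply mul_left_cancel₀ this
    rw [hn]; ring
  have h3 : f i = g i + n := by exact_mod_cast h2
  have hn1 : (n : ℝ) < 1 := by linarith [(hf i).2, (hg i).1]
  have hn2 : (-1 : ℝ) < n := by linarith [(hg i).2, (hf i).1]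
  have : n = 0 := by
    have h4 : n < 1 := by exact_mod_cast hn1
    have h5 : -1 < n := by exact_mod_cast hn2
    omega
  simpa [this] using h3

theorem exists_phase_eq {z : Fin d → ℂ} (hz : ∀ i, ‖z i‖ = 1) :
    ∃ f : Fin d → ℝ, (∀ i, f i ∈ Set.Ico (0 : ℝ) 1) ∧ phase f = z := by
  refine ⟨fun i => Int.fract (Complex.arg (z i) / (2 * Real.pi)),
    fun i => ⟨Int.fract_nonneg _, Int.fract_lt_one _⟩, funext fun i => ?_⟩
  have h := Complex.norm_mul_exp_arg_mul_I (z i)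
  rw [hz i, Complex.ofReal_one, one_mul] at h
  rw [phase, ← h, Complex.exp_eq_exp_iff_exists_int]
  rw [h]
  refine ⟨-⌊Complex.arg (z i) / (2 * Real.pi)⌋, ?_⟩
  rw [← Int.self_sub_floor]
  have : (Real.pi : ℂ) ≠ 0 := by exact_mod_cast Real.pi_ne_zero
  push_cast
  field_simp
  ring

/-! ### Separation of frequencies -/

/-- Points of `ℂ^d` are separated by polynomials of low degree in each variable: the interpolating
product has one linear factor, in a variable that separates, for each point to be killed. -/
theorem exists_separating {N : Fin d → ℕ} {ι : Type*} [Fintype ι] (z : ι → Fin d → ℂ)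
    (x : Fin d → ℂ) (hx : ∀ l, z l ≠ x) (hN : ∀ i, Fintype.card ι < N i) :
    ∃ p : MultiIndex N → ℂ, (∀ l, ∑ k, p k * ∏ i, z l i ^ (k i : ℕ) = 0) ∧
      ∑ k, p k * ∏ i, x i ^ (k i : ℕ) = 1 := by
  classical
  choose j hj using fun l => Function.ne_iff.1 (hx l)
  let P : MvPolynomial (Fin d) ℂ := ∏ l, (MvPolynomial.C (x (j l) - z l (j l))⁻¹ *
    (MvPolynomial.X (j l) - MvPolynomial.C (z l (j l))))
  have hdeg : ∀ i, P.degreeOf i ≤ Fintype.card ι := by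
    intro i
    refine (MvPolynomial.degreeOf_prod_le i _ _).trans ?_
    refine (Finset.sum_le_card_nsmul _ _ 1 fun l _ => ?_).trans_eq (by simp)
    refine (MvPolynomial.degreeOf_mul_le i _ _).trans ?_
    rw [MvPolynomial.degreeOf_C, zero_add]
    refine (MvPolynomial.degreeOf_sub_le i _ _).trans ?_
    rw [MvPolynomial.degreeOf_C, MvPolynomial.degreeOf_X]
    split_ifs <;> simp
  have heval : ∀ y : Fin d → ℂ, MvPolynomial.eval y P =
      ∑ k : MultiIndex N, P.coeff (Finsupp.equivFunOnFinite.symm fun i => (k i : ℕ)) *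
        ∏ i, y i ^ (k i : ℕ) := by
    intro y
    rw [MvPolynomial.eval_eq']
    have hinj : Function.Injective fun k : MultiIndex N =>
        Finsupp.equivFunOnFinite.symm fun i => (k i : ℕ) := by
      intro k k' h
      funext i
      exact Fin.ext (congrFun (Finsupp.equivFunOnFinite.symm.injective h) i)
    rw [Finset.sum_subset (s₂ := Finset.univ.map ⟨_, hinj⟩), Finset.sum_map]
    · rfl
    · intro e he
      have hlt : ∀ i, e i < N i := fun i =>
        ((MvPolynomial.degreeOf_le_iff.1 (hdeg i)) e he).trans_lt (hN i)
      refine Finset.mem_map.2 ⟨fun i => ⟨e i, hlt i⟩, Finset.mem_univ _, ?_⟩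
      ext i; rfl
    · intro e _ he
      rw [MvPolynomial.notMem_support_iff.1 he, zero_mul]
  refine ⟨fun k => P.coeff (Finsupp.equivFunOnFinite.symm fun i => (k i : ℕ)), fun l => ?_, ?_⟩
  · rw [← heval, map_prod]
    exact Finset.prod_eq_zero (Finset.mem_univ l) (by simp)
  · rw [← heval, map_prod]
    refine Finset.prod_eq_one fun l _ => ?_
    have : x (j l) - z l (j l) ≠ 0 := sub_ne_zero.2 (hj l).symm
    simp [this]

/-- The form is evaluated at `star p`, which turns `p ⬝ᵥ atom N f` into the value at the point
`phase f` of the polynomial with coefficients `p`. -/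
theorem quadForm_sum_atoms {N : Fin d → ℕ} {ι : Type*} [Fintype ι] (c : ι → ℝ)
    (f : ι → Fin d → ℝ) (p : MultiIndex N → ℂ) :
    star (star p) ⬝ᵥ ((∑ l, (c l : ℂ) • Matrix.vecMulVec (atom N (f l)) (star (atom N (f l)))).mulVec
      (star p)) = ∑ l, (c l : ℂ) * ((p ⬝ᵥ atom N (f l)) * star (p ⬝ᵥ atom N (f l))) := by
  rw [Matrix.sum_mulVec, dotProduct_sum]
  refine Finset.sum_congr rfl fun l _ => ?_
  rw [Matrix.smul_mulVec, Matrix.vecMulVec_mulVec, dotProduct_smul, star_star,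
    Matrix.star_dotProduct_star, smul_eq_mul]
  congr 1
  simp [dotProduct_smul, mul_comm]

/-- Atoms with distinct frequencies are linearly independent when there are at most `Nᵢ` of them for
every `i`, and `p` is a member of a dual family. -/
theorem exists_dual {N : Fin d → ℕ} {ι : Type*} [Fintype ι] {f : ι → Fin d → ℝ}
    (hf : Function.Injective fun l => phase (f l)) (hN : ∀ i, Fintype.card ι ≤ N i) (l : ι) :
    ∃ p : MultiIndex N → ℂ, p ⬝ᵥ atom N (f l) = 1 ∧ ∀ l', l' ≠ l → p ⬝ᵥ atom N (f l') = 0 := by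
  classical
  obtain ⟨p, h0, h1⟩ := exists_separating (N := N) (fun l' : {l' // l' ≠ l} => phase (f l'))
    (phase (f l)) (fun l' h => l'.2 (hf h))
    (fun i => (Fintype.card_subtype_lt (x := l) (by simp)).trans_le (hN i))
  refine ⟨p, ?_, fun l' hl' => ?_⟩
  · simpa only [dotProduct, atom_apply] using h1
  · simpa only [dotProduct, atom_apply] using h0 ⟨l', hl'⟩

theorem posSemidef_sum_atoms {N : Fin d → ℕ} {ι : Type*} [Fintype ι] {c : ι → ℝ}
    (hc : ∀ l, 0 ≤ c l) (f : ι → Fin d → ℝ) :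
    (∑ l, (c l : ℂ) • Matrix.vecMulVec (atom N (f l)) (star (atom N (f l)))).PosSemidef :=
  Matrix.posSemidef_sum _ fun l _ =>
    (Matrix.posSemidef_vecMulVec_self_star _).smul (by exact_mod_cast hc l)

theorem weights_nonneg_of_posSemidef {N : Fin d → ℕ} {ι : Type*} [Fintype ι] {c : ι → ℝ}
    {f : ι → Fin d → ℝ} (hf : Function.Injective fun l => phase (f l))
    (hN : ∀ i, Fintype.card ι ≤ N i)
    (h : (∑ l, (c l : ℂ) • Matrix.vecMulVec (atom N (f l)) (star (atom N (f l)))).PosSemidef)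
    (l : ι) : 0 ≤ c l := by
  obtain ⟨p, h1, h0⟩ := exists_dual hf hN l
  have := h.dotProduct_mulVec_nonneg (star p)
  rw [quadForm_sum_atoms, Finset.sum_eq_single l (fun l' _ hl' => by simp [h0 l' hl']) (by simp),
    h1] at this
  simpa using this

/-! ### The trigonometric polynomial of a frequency interval -/

/-- The values `-4 sign(f_H - f_L) sin(π(x - f_L)) sin(π(x - f_H))` of the trigonometric polynomial
with coefficients `coeff fL fH`, in factored form. -/
def trigPoly (fL fH x : ℝ) : ℝ :=
  -4 * Real.sign (fH - fL) * (Real.sin (Real.pi * (x - fL)) * Real.sin (Real.pi * (x - fH)))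

theorem sum_coeff_mul_zpow (fL fH x : ℝ) :
    ∑ k ∈ Finset.Icc (-1 : ℤ) 1, coeff fL fH k *
      Complex.exp (2 * Real.pi * Complex.I * x) ^ (-k) = (trigPoly fL fH x : ℂ) := by
  have hI : Finset.Icc (-1 : ℤ) 1 = {-1, 0, 1} := by decide
  rw [hI, Finset.sum_insert (by decide), Finset.sum_insert (by decide), Finset.sum_singleton]
  have h1 : coeffOne fL fH * Complex.exp (2 * Real.pi * Complex.I * x) ^ (-1 : ℤ) =
      Complex.exp (-((Real.pi * (2 * x - fL - fH) : ℝ) * Complex.I)) *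
        (Real.sign (fH - fL) : ℂ) := by
    rw [coeffOne, zpow_neg_one, ← Complex.exp_neg, mul_right_comm, ← Complex.exp_add]
    congr 2
    push_cast
    ring
  have h2 : star (coeffOne fL fH) * Complex.exp (2 * Real.pi * Complex.I * x) ^ (1 : ℤ) =
      Complex.exp ((Real.pi * (2 * x - fL - fH) : ℝ) * Complex.I) *
        (Real.sign (fH - fL) : ℂ) := by
    rw [coeffOne, zpow_one, star_mul', mul_right_comm, Complex.star_def,
      ← Complex.exp_conj, Complex.conj_ofReal, ← Complex.exp_add]
    congr 2
    simp only [map_mul, map_add, Complex.conj_I, Complex.conj_ofReal]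
    push_cast
    ring
  have hcos : 2 * Real.cos (Real.pi * (2 * x - fL - fH)) - 2 * Real.cos (Real.pi * (fH - fL)) =
      -4 * (Real.sin (Real.pi * (x - fL)) * Real.sin (Real.pi * (x - fH))) := by
    rw [show Real.pi * (2 * x - fL - fH) = Real.pi * (x - fL) + Real.pi * (x - fH) by ring,
      show Real.pi * (fH - fL) = Real.pi * (x - fL) - Real.pi * (x - fH) by ring,
      Real.cos_add, Real.cos_sub]
    ring
  simp only [coeff, neg_neg]
  norm_num only
  simp only [if_true, if_false]
  have htrig : trigPoly fL fH x = Real.sign (fH - fL) *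
      (2 * Real.cos (Real.pi * (2 * x - fL - fH)) - 2 * Real.cos (Real.pi * (fH - fL))) := by
    rw [hcos, trigPoly]
    ring
  have := Complex.two_cos (((Real.pi * (2 * x - fL - fH) : ℝ) : ℂ))
  rw [neg_mul] at this
  rw [h1, h2, htrig, coeffZero, zpow_zero, mul_one]
  push_cast at this ⊢
  linear_combination -(Real.sign (fH - fL) : ℂ) * this

theorem trigPoly_nonneg_iff {fL fH x : ℝ} (hL : fL ∈ Set.Ico (0 : ℝ) 1)
    (hH : fH ∈ Set.Ico (0 : ℝ) 1) (hne : fL ≠ fH) (hx : x ∈ Set.Ico (0 : ℝ) 1) :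
    0 ≤ trigPoly fL fH x ↔ x ∈ freqInterval fL fH := by
  have hpos : ∀ y : ℝ, 0 < y → y < 1 → 0 < Real.sin (Real.pi * y) := fun y h0 h1 =>
    Real.sin_pos_of_pos_of_lt_pi (by positivity) (by nlinarith [Real.pi_pos])
  have hneg : ∀ y : ℝ, y < 0 → -1 < y → Real.sin (Real.pi * y) < 0 := fun y h0 h1 =>
    Real.sin_neg_of_neg_of_neg_pi_lt (by nlinarith [Real.pi_pos]) (by nlinarith [Real.pi_pos])
  -- All differences lie in `(-1, 1)`, so each sine has the sign of its argument.
  obtain ⟨hL0, hL1⟩ := hL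
  obtain ⟨hH0, hH1⟩ := hH
  obtain ⟨hx0, hx1⟩ := hx
  rw [trigPoly, freqInterval]
  have hsinL : x < fL → Real.sin (Real.pi * (x - fL)) < 0 := fun h =>
    hneg _ (by linarith) (by linarith)
  have hsinL' : fL ≤ x → 0 ≤ Real.sin (Real.pi * (x - fL)) := fun h => by
    rcases h.eq_or_lt with rfl | h
    · simp
    · exact (hpos _ (by linarith) (by linarith)).le
  have hsinH : fH < x → 0 < Real.sin (Real.pi * (x - fH)) := fun h =>
    hpos _ (by linarith) (by linarith)
  have hsinH' : x ≤ fH → Real.sin (Real.pi * (x - fH)) ≤ 0 := fun h => by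
    rcases h.eq_or_lt with rfl | h
    · simp
    · exact (hneg _ (by linarith) (by linarith)).le
  have hsinLp : fL < x → 0 < Real.sin (Real.pi * (x - fL)) := fun h =>
    hpos _ (by linarith) (by linarith)
  have hsinHn : x < fH → Real.sin (Real.pi * (x - fH)) < 0 := fun h =>
    hneg _ (by linarith) (by linarith)
  rcases lt_or_gt_of_ne hne with hlt | hlt
  · rw [if_pos hlt, Real.sign_of_pos (by linarith), Set.mem_Icc]
    constructor
    · intro h
      by_contra hcon
      rw [not_and_or, not_le, not_le] at hcon
      rcases hcon with hc | hc
      · nlinarith [mul_pos_of_neg_of_neg (hsinL hc) (hsinHn (by linarith))]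
      · nlinarith [mul_pos (hsinLp (by linarith)) (hsinH hc)]
    · rintro ⟨h1, h2⟩
      nlinarith [mul_nonneg (hsinL' h1) (neg_nonneg.2 (hsinH' h2))]
  · rw [if_neg hlt.not_gt, Real.sign_of_neg (by linarith)]
    constructor
    · intro h
      refine ⟨⟨hx0, hx1⟩, fun hc => ?_⟩
      nlinarith [mul_pos (neg_pos.2 (hsinL hc.2)) (hsinH hc.1)]
    · rintro ⟨-, hc⟩
      rw [Set.mem_Ioo, not_and_or, not_lt, not_lt] at hc
      rcases hc with hc | hc
      · nlinarith [mul_nonneg_of_nonpos_of_nonpos (hsinL (by linarith)).le (hsinH' hc)]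
      · nlinarith [mul_nonneg (hsinL' hc) (hsinH (by linarith)).le]

/-! ### Toeplitz entries of sums of atoms -/

theorem atom_mul_star_atom (N : Fin d → ℕ) (f : Fin d → ℝ) (m n : MultiIndex N) :
    atom N f m * star (atom N f n) = ∏ i, phase f i ^ lag m n i := by
  rw [atom_apply, atom_apply, Complex.star_def, map_prod, ← Finset.prod_mul_distrib]
  refine Finset.prod_congr rfl fun i _ => ?_
  rw [map_pow, conj_eq_inv_of_norm_eq_one (norm_phase f i), lag, zpow_sub₀ (phase_ne_zero f i),
    zpow_natCast, zpow_natCast, inv_pow, div_eq_mul_inv]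

theorem sum_atoms_apply {N : Fin d → ℕ} {ι : Type*} [Fintype ι] (c : ι → ℝ)
    (f : ι → Fin d → ℝ) (m n : MultiIndex N) :
    (∑ l, (c l : ℂ) • Matrix.vecMulVec (atom N (f l)) (star (atom N (f l)))) m n =
      ∑ l, (c l : ℂ) * ∏ i, phase (f l) i ^ lag m n i := by
  rw [Matrix.sum_apply]
  refine Finset.sum_congr rfl fun l _ => ?_
  rw [Matrix.smul_apply, Matrix.vecMulVec_apply, Pi.star_apply, atom_mul_star_atom, smul_eq_mul]

theorem exists_lag_eq {N : Fin d → ℕ} {t : Fin d → ℤ} (ht : ∀ i, |t i| < N i) :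
    ∃ m n : MultiIndex N, lag m n = t := by
  refine ⟨fun i => ⟨(t i).toNat, ?_⟩, fun i => ⟨(-t i).toNat, ?_⟩, funext fun i => ?_⟩
  · have := abs_lt.1 (ht i); omega
  · have := abs_lt.1 (ht i); omega
  · simp only [lag]; omega

/-- Filtering the tensor by the coefficients of `g` multiplies the weights by `g`. -/
theorem weightedToeplitz_eq_sum {N : Fin d → ℕ} {B : (Fin d → ℤ) → ℂ} {ι : Type*} [Fintype ι]
    {c : ι → ℝ} {f : ι → Fin d → ℝ}
    (h : blockToeplitz N B =
      ∑ l, (c l : ℂ) • Matrix.vecMulVec (atom N (f l)) (star (atom N (f l))))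
    (i : Fin d) (fL fH : ℝ) :
    weightedToeplitz N B i fL fH =
      ∑ l, ((c l * trigPoly fL fH (f l i) : ℝ) : ℂ) •
        Matrix.vecMulVec (atom (fun j => N j - 1) (f l)) (star (atom (fun j => N j - 1) (f l))) := by
  -- All lags occurring in `T_g` are lags of `T`, where `B` is known.
  have hB : ∀ t : Fin d → ℤ, (∀ j, |t j| < N j) →
      B t = ∑ l, (c l : ℂ) * ∏ j, phase (f l) j ^ t j := by
    intro t ht
    obtain ⟨m, n, rfl⟩ := exists_lag_eq ht
    rw [← sum_atoms_apply, ← h]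
    rfl
  ext m n
  rw [sum_atoms_apply]
  change ∑ k ∈ Finset.Icc (-1 : ℤ) 1, coeff fL fH k * B (lag m n - Pi.single i k) = _
  have hprod : ∀ (l : ι) (k : ℤ), ∏ j, phase (f l) j ^ (lag m n - Pi.single i k : Fin d → ℤ) j =
      (∏ j, phase (f l) j ^ lag m n j) * phase (f l) i ^ (-k) := by
    intro l k
    simp only [Pi.sub_apply, zpow_sub₀ (phase_ne_zero (f l) _), Finset.prod_div_distrib]
    rw [Finset.prod_eq_single (f := fun j => phase (f l) j ^ (Pi.single i k : Fin d → ℤ) j) i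
      (fun j _ hj => by simp [hj]) (by simp)]
    simp [div_eq_mul_inv]
  have hlag : ∀ k ∈ Finset.Icc (-1 : ℤ) 1, ∀ j, |(lag m n - Pi.single i k : Fin d → ℤ) j| < N j := by
    intro k hk j
    rw [Finset.mem_Icc] at hk
    have h1 : (m j : ℕ) < N j - 1 := (m j).2
    have h2 : (n j : ℕ) < N j - 1 := (n j).2
    rcases eq_or_ne j i with rfl | hj
    · simp only [Pi.sub_apply, Pi.single_eq_same, lag, abs_lt]; omega
    · simp only [Pi.sub_apply, Pi.single_eq_of_ne hj, lag, abs_lt]; omega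
  rw [Finset.sum_congr rfl fun k hk => by rw [hB _ (hlag k hk), Finset.mul_sum], Finset.sum_comm]
  refine Finset.sum_congr rfl fun l _ => ?_
  rw [Complex.ofReal_mul, ← sum_coeff_mul_zpow, Finset.mul_sum, Finset.sum_mul]
  refine Finset.sum_congr rfl fun k _ => ?_
  rw [hprod, phase]
  ring

/-! ### Uniqueness -/

theorem IsVandermondeDecomposition.injective_phase {N : Fin d → ℕ}
    {T : Matrix (MultiIndex N) (MultiIndex N) ℂ} {σ : Fin T.rank → ℝ} {f : Fin T.rank → Fin d → ℝ}
    (h : IsVandermondeDecomposition T σ f) : Function.Injective fun l => phase (f l) :=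
  fun l l' hl => h.distinct (phase_injOn (h.mem_unit l) (h.mem_unit l') hl)

theorem IsVandermondeDecomposition.quadForm {N : Fin d → ℕ}
    {T : Matrix (MultiIndex N) (MultiIndex N) ℂ} {σ : Fin T.rank → ℝ} {f : Fin T.rank → Fin d → ℝ}
    (h : IsVandermondeDecomposition T σ f) (p : MultiIndex N → ℂ) :
    star (star p) ⬝ᵥ T.mulVec (star p) =
      ∑ l, (σ l : ℂ) * ((p ⬝ᵥ atom N (f l)) * star (p ⬝ᵥ atom N (f l))) :=
  (congrArg (fun M => star (star p) ⬝ᵥ M.mulVec (star p)) h.eq_sum).trans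
    (quadForm_sum_atoms σ f p)

/-- A polynomial killing all frequencies of one decomposition but not a given frequency of the
other would make the quadratic form of `T` both zero and positive. -/
theorem IsVandermondeDecomposition.exists_eq {N : Fin d → ℕ}
    {T : Matrix (MultiIndex N) (MultiIndex N) ℂ} (hN : ∀ i, T.rank < N i)
    {σ σ' : Fin T.rank → ℝ} {f f' : Fin T.rank → Fin d → ℝ}
    (h : IsVandermondeDecomposition T σ f) (h' : IsVandermondeDecomposition T σ' f')
    (l : Fin T.rank) : ∃ l', f l' = f' l := by
  by_contra! hcon
  obtain ⟨p, h0, h1⟩ := exists_separating (N := N) (fun l' => phase (f l')) (phase (f' l))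
    (fun l' he => hcon l' (phase_injOn (h.mem_unit l') (h'.mem_unit l) he)) (by simpa using hN)
  have e0 : ∀ l', p ⬝ᵥ atom N (f l') = 0 := fun l' => by
    simpa only [dotProduct, atom_apply] using h0 l'
  have e1 : p ⬝ᵥ atom N (f' l) = 1 := by simpa only [dotProduct, atom_apply] using h1
  have q := (h'.quadForm p).symm.trans (h.quadForm p)
  simp only [e0, zero_mul, mul_zero, Finset.sum_const_zero, Complex.star_def, Complex.mul_conj]
    at q
  have q' : ∑ l', σ' l' * Complex.normSq (p ⬝ᵥ atom N (f' l')) = 0 := by exact_mod_cast q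
  have := (Finset.sum_eq_zero_iff_of_nonneg fun l' _ =>
    mul_nonneg (h'.pos l').le (Complex.normSq_nonneg _)).1 q' l (Finset.mem_univ l)
  rw [e1] at this
  simp [(h'.pos l).ne'] at this

theorem IsVandermondeDecomposition.unique {N : Fin d → ℕ}
    {T : Matrix (MultiIndex N) (MultiIndex N) ℂ} (hN : ∀ i, T.rank < N i)
    {σ σ' : Fin T.rank → ℝ} {f f' : Fin T.rank → Fin d → ℝ}
    (h : IsVandermondeDecomposition T σ f) (h' : IsVandermondeDecomposition T σ' f') :
    ∃ π : Equiv.Perm (Fin T.rank), σ' = σ ∘ π ∧ f' = f ∘ π := by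
  choose π hπ using h.exists_eq hN h'
  have hinj : Function.Injective π := fun l l' hl =>
    h'.distinct (by rw [← hπ l, ← hπ l', hl])
  refine ⟨Equiv.ofBijective π (Finite.injective_iff_bijective.1 hinj), funext fun l => ?_,
    funext fun l => (hπ l).symm⟩
  obtain ⟨p, h1, h0⟩ := exists_dual (N := N) h.injective_phase
    (fun i => by simpa using (hN i).le) (π l)
  have q := (h'.quadForm p).symm.trans (h.quadForm p)
  rw [Finset.sum_eq_single l (fun l' _ hl' => by rw [← hπ l', h0 _ (hinj.ne hl')]; simp) (by simp),
    Finset.sum_eq_single (π l) (fun l' _ hl' => by rw [h0 _ hl']; simp) (by simp),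
    ← hπ l, h1] at q
  simpa using q

/-! ### Existence -/

/-- A Toeplitz Gram matrix of a spanning family in a space of dimension below every `Nᵢ` is a
positive combination of rank-one atoms: the spectral representation of the family diagonalizes
it. -/
theorem exists_sum_atoms_of_gram [FiniteDimensional ℂ E] {N : Fin d → ℕ} {B : (Fin d → ℤ) → ℂ}
    {u : MultiIndex N → E}
    (hu : ∀ m n, inner ℂ (u m) (u n) = B (lag m n)) (hN : ∀ i, Module.finrank ℂ E < N i)
    (hspan : Submodule.span ℂ (Set.range u) = ⊤) :
    ∃ (ι : Type) (_ : Fintype ι) (σ : ι → ℝ) (f : ι → Fin d → ℝ),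
      (∀ l, 0 < σ l) ∧ (∀ l i, f l i ∈ Set.Ico (0 : ℝ) 1) ∧ Function.Injective f ∧
      Fintype.card ι ≤ Module.finrank ℂ E ∧
      blockToeplitz N B =
        ∑ l, (σ l : ℂ) • Matrix.vecMulVec (atom N (f l)) (star (atom N (f l))) := by
  classical
  let w : (Fin d → ℕ) → E := fun m => if h : ∀ i, m i < N i then u fun i => ⟨m i, h i⟩ else 0
  have hw : ∀ m (h : m ∈ box N), w m = u fun i => ⟨m i, h i⟩ := fun m h => dif_pos h
  have hstat : IsStationaryOn N w := by
    intro m hm n hn m' hm' n' hn' heq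
    rw [hw m hm, hw n hn, hw m' hm', hw n' hn', hu, hu]
    congr 1
    exact funext heq
  have hrange : w '' box N = Set.range u := by
    ext x
    constructor
    · rintro ⟨m, hm, rfl⟩
      exact ⟨_, (hw m hm).symm⟩
    · rintro ⟨m, rfl⟩
      exact ⟨fun i => m i, fun i => (m i).2, hw _ fun i => (m i).2⟩
  obtain ⟨c, hnorm, horth, hrep⟩ :=
    exists_spectral_representation hstat hN (by rw [hrange, hspan])
  -- The inner product is conjugate-linear in its first argument, so the frequencies are those of
  -- the conjugate characters.
  have hex : ∀ χ : c.support, ∃ f : Fin d → ℝ, (∀ i, f i ∈ Set.Ico (0 : ℝ) 1) ∧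
      phase f = fun i => starRingEnd ℂ (χ.1 i) := fun χ =>
    exists_phase_eq fun i => by rw [Complex.norm_conj, hnorm χ.1 χ.2 i]
  choose g hg01 hg using hex
  refine ⟨c.support, inferInstance, fun χ => ‖c χ.1‖ ^ 2, g, fun χ => ?_, hg01, fun χ ψ h => ?_,
    ?_, ?_⟩
  · exact pow_pos (norm_pos_iff.2 (Finsupp.mem_support_iff.1 χ.2)) 2
  · refine Subtype.ext (funext fun i => ?_)
    have h2 : phase (g χ) = phase (g ψ) := congrArg phase h
    rw [hg, hg] at h2
    exact (starRingEnd ℂ).injective (congrFun h2 i)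
  · exact (linearIndependent_of_ne_zero_of_inner_eq_zero (𝕜 := ℂ)
      (v := fun χ : c.support => c χ.1) (fun χ => Finsupp.mem_support_iff.1 χ.2)
      (fun χ ψ hne => horth _ _ fun h => hne (Subtype.ext h))).fintype_card_le_finrank
  · ext m n
    have hm : u m = _ := (hw _ fun i => (m i).2).symm.trans (hrep _ fun i => (m i).2)
    have hn : u n = _ := (hw _ fun i => (n i).2).symm.trans (hrep _ fun i => (n i).2)
    change B (lag m n) = _
    rw [← hu, hm, hn, Matrix.sum_apply, sum_inner, ← Finset.sum_coe_sort]
    refine Finset.sum_congr rfl fun χ _ => ?_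
    rw [inner_sum, Finset.sum_eq_single χ.1
      (fun ψ _ hψ => by rw [inner_smul_left, inner_smul_right, horth _ _ hψ.symm]; simp)
      (fun h => absurd χ.2 h), inner_smul_left, inner_smul_right, inner_self_eq_norm_sq_to_K,
      Matrix.smul_apply, Matrix.vecMulVec_apply, Pi.star_apply, atom_apply, atom_apply, hg]
    simp only [map_prod, map_pow, Complex.star_def, Complex.conj_conj, smul_eq_mul,
      Complex.ofReal_pow, Complex.coe_algebraMap]
    ring

theorem rank_sum_atoms_le {N : Fin d → ℕ} {ι : Type*} [Fintype ι] (c : ι → ℝ)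
    (f : ι → Fin d → ℝ) :
    (∑ l, (c l : ℂ) • Matrix.vecMulVec (atom N (f l)) (star (atom N (f l)))).rank ≤
      Fintype.card ι := by
  have hfac : ∑ l, (c l : ℂ) • Matrix.vecMulVec (atom N (f l)) (star (atom N (f l))) =
      (Matrix.of fun m l => (c l : ℂ) * atom N (f l) m) *
        (Matrix.of fun l n => star (atom N (f l) n)) := by
    ext m n
    simp [Matrix.sum_apply, Matrix.mul_apply, Matrix.vecMulVec_apply, mul_assoc]
  rw [hfac]
  exact (Matrix.rank_mul_le_right _ _).trans (Matrix.rank_le_card_height _)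

open scoped MatrixOrder Matrix.Norms.L2Operator in
theorem exists_eq_conjTranspose_mul_self {n : Type*} [Fintype n] {T : Matrix n n ℂ}
    (hT : T.PosSemidef) : ∃ A : Matrix n n ℂ, T = A.conjTranspose * A := by
  classical
  exact CStarAlgebra.nonneg_iff_eq_star_mul_self.1 hT.nonneg

/-- The number of atoms equals the rank: the upper bound is the dimension of the span of the Gram
vectors, the lower bound is that each atom has rank one. -/
theorem exists_isVandermondeDecomposition {N : Fin d → ℕ} {B : (Fin d → ℤ) → ℂ}
    (hT : (blockToeplitz N B).PosSemidef) (hN : ∀ i, (blockToeplitz N B).rank < N i) :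
    ∃ σ f, IsVandermondeDecomposition (blockToeplitz N B) σ f := by
  obtain ⟨A, hA⟩ := exists_eq_conjTranspose_mul_self hT
  let e := (WithLp.linearEquiv 2 ℂ (MultiIndex N → ℂ)).symm
  let v : MultiIndex N → EuclideanSpace ℂ (MultiIndex N) := fun m => e (A.col m)
  let E : Submodule ℂ (EuclideanSpace ℂ (MultiIndex N)) := Submodule.span ℂ (Set.range v)
  have hdim : Module.finrank ℂ E = (blockToeplitz N B).rank := by
    rw [hA, Matrix.rank_conjTranspose_mul_self, Matrix.rank_eq_finrank_span_cols,
      ← LinearEquiv.finrank_map_eq e, Submodule.map_span, ← Set.range_comp]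
    rfl
  let u : MultiIndex N → E := fun m => ⟨v m, Submodule.subset_span ⟨m, rfl⟩⟩
  have hu : ∀ m n, inner ℂ (u m) (u n) = B (lag m n) := by
    intro m n
    change inner ℂ (v m) (v n) = blockToeplitz N B m n
    rw [hA, Matrix.mul_apply, PiLp.inner_apply]
    refine Finset.sum_congr rfl fun k _ => ?_
    simp [v, e, mul_comm]
  have hspan : Submodule.span ℂ (Set.range u) = ⊤ := by
    refine Submodule.map_injective_of_injective E.injective_subtype ?_
    rw [Submodule.map_span, ← Set.range_comp, Submodule.map_top, Submodule.range_subtype]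
    rfl
  obtain ⟨ι, _, σ, f, hσ, hf, hinj, hcard, hsum⟩ :=
    exists_sum_atoms_of_gram hu (fun i => hdim ▸ hN i) hspan
  have hcard' : Fintype.card ι = (blockToeplitz N B).rank :=
    le_antisymm (hcard.trans_eq hdim)
      ((congrArg Matrix.rank hsum).trans_le (rank_sum_atoms_le σ f))
  let eq : Fin (blockToeplitz N B).rank ≃ ι := (Fintype.equivFinOfCardEq hcard').symm
  exact ⟨σ ∘ eq, f ∘ eq, fun l => hσ _, fun l => hf _, hinj.comp eq.injective,
    hsum.trans (Equiv.sum_comp eq fun l => (σ l : ℂ) •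
      Matrix.vecMulVec (atom N (f l)) (star (atom N (f l)))).symm⟩

end MDToeplitz

end

/-! ### Frequency-constrained decompositions -/

theorem theorem2 {d : ℕ} (hd : 2 ≤ d) (N : Fin d → ℕ) (B : (Fin d → ℤ) → ℂ)
    (hrank : ∀ i, (MDToeplitz.blockToeplitz N B).rank < N i)
    (fL fH : Fin d → ℝ)
    (hL : ∀ i, fL i ∈ Set.Ico (0 : ℝ) 1) (hH : ∀ i, fH i ∈ Set.Ico (0 : ℝ) 1)
    (hne : ∀ i, fL i ≠ fH i) :
    ((∃ (σ : Fin (MDToeplitz.blockToeplitz N B).rank → ℝ)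
        (f : Fin (MDToeplitz.blockToeplitz N B).rank → Fin d → ℝ),
        MDToeplitz.IsVandermondeDecomposition (MDToeplitz.blockToeplitz N B) σ f ∧
          ∀ l i, f l i ∈ MDToeplitz.freqInterval (fL i) (fH i)) ↔
      ((MDToeplitz.blockToeplitz N B).PosSemidef ∧
        ∀ i, (MDToeplitz.weightedToeplitz N B i (fL i) (fH i)).PosSemidef)) ∧
    (∀ (σ σ' : Fin (MDToeplitz.blockToeplitz N B).rank → ℝ)
        (f f' : Fin (MDToeplitz.blockToeplitz N B).rank → Fin d → ℝ),
        MDToeplitz.IsVandermondeDecomposition (MDToeplitz.blockToeplitz N B) σ f →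
        MDToeplitz.IsVandermondeDecomposition (MDToeplitz.blockToeplitz N B) σ' f' →
        ∃ π : Equiv.Perm (Fin (MDToeplitz.blockToeplitz N B).rank),
          σ' = σ ∘ π ∧ f' = f ∘ π) := by
  refine ⟨⟨?_, ?_⟩, fun σ σ' f f' h h' => h.unique hrank h'⟩
  · rintro ⟨σ, f, h, hmem⟩
    refine ⟨?_, fun i => ?_⟩
    · rw [h.eq_sum]
      exact MDToeplitz.posSemidef_sum_atoms (fun l => (h.pos l).le) f
    · rw [MDToeplitz.weightedToeplitz_eq_sum h.eq_sum]
      exact MDToeplitz.posSemidef_sum_atoms (fun l => mul_nonneg (h.pos l).le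
        ((MDToeplitz.trigPoly_nonneg_iff (hL i) (hH i) (hne i) (h.mem_unit l i)).2 (hmem l i))) f
  · rintro ⟨hT, hTg⟩
    obtain ⟨σ, f, h⟩ := MDToeplitz.exists_isVandermondeDecomposition hT hrank
    refine ⟨σ, f, h, fun l i => ?_⟩
    have hpsd := hTg i
    rw [MDToeplitz.weightedToeplitz_eq_sum h.eq_sum] at hpsd
    -- `rank T ≤ Nⱼ - 1` keeps the shortened atoms separated.
    have hnonneg := MDToeplitz.weights_nonneg_of_posSemidef h.injective_phase
      (fun j => by rw [Fintype.card_fin]; have := hrank j; omega) hpsd l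
    exact (MDToeplitz.trigPoly_nonneg_iff (hL i) (hH i) (hne i) (h.mem_unit l i)).1
      (nonneg_of_mul_nonneg_right hnonneg (h.pos l))
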